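/- Let $(K,v)$ be a henselian valued field of arbitrary rank, with valuation written additively; write $v$ also for its unique extension to a fixed algebraic closure $\overline K$ of $K$, and for a subfield $F$ of $\overline K$ write $vF$, $Fv$, $\mathcal O_F$, $\mathcal M_F$ for the value group, residue field, valuation ring and maximal ideal of $(F,v)$. For $z\in\overline K$ let $\deg_K(z)=[K(z):K]$. *Depth.* For $a\in\overline K\setminus K$ and $1\le d<\deg_K(a)$ put $D_d=\{v(z-a)\mid z\in\overline K,\ \deg_K(z)=d\}$. An Okutsu sequence of length $n$ of $a$ over $K$ is a sequence $A_0=\{a\},A_1,\dots,A_n$ of subsets of $\overline K$, all elements of $A_i$ having the same degree $d_i$ over $K$, such that $\deg_K(a)=d_0>d_1>\dots>d_n=1$ and, for all $1\le i\le n$: 1. for every $z\in\overline K$ with $\deg_K(z)<d_{i-1}$ there is $z_i\in A_i$ with $v(a-z_i)\ge v(a-z)$; 2. $v(a-z_{i-1})>v(a-z_i)$ for all $z_{i-1}\in A_{i-1}$ and $z_i\in A_i$; 3. $\#A_i=1$ if and only if $\max D_{d_i}$ exists, and in that case $A_i=\{a_i\}$ with $v(a-a_i)=\max D_{d_i}=\max\{v(a-z)\mid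 \deg_K(z)<d_{i-1}\}$; 4. if $\max D_{d_i}$ does not exist, then $A_i=\{z_\nu\}_{\nu<\lambda}$ for a limit ordinal $\lambda$, with $v(a-z_\mu)>v(a-z_\nu)$ whenever $\nu<\mu<\lambda$. All Okutsu sequences of $a$ over $K$ have the same length, which is called the depth $\ell_K(a)$ of $a$ over $K$; the element $a$ is pure over $K$ if $\ell_K(a)=1$. The depth of a finite simple extension $(\Omega|K,v)$ is $\min\{\ell_K(a)\mid K(a)=\Omega\}$. *Conjugates and ramification ideals.* For $a\in\overline K\setminus K$ separable over $K$ put $$S_K(a)=\{v(a-a')\mid a'\ne a \text{ is a } K\text{-conjugate of } a\}.$$ For a Galois extension $\Omega|K$ inside $\overline K$ and a subgroup $H$ of $\mathrm{Gal}(\Omega|K)$ let $\mathcal I_H$ be the ideal of $\mathcal O_\Omega$ generated by all $\frac{\sigma z}{z}-1$ with $\sigma\in H$ and $z\in\Omega^\times$. A ramification ideal of $\mathcal E=(\Omega|K,v)$ is an ideal $\mathcal I$ of $\mathcal O_\Omega$ with $(0)\subsetneq\mathcal I\subseteq\mathcal M_\Omega$ and $\mathcal I=\mathcal I_H$ for some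 subgroup $H$; let $\mathrm{Ram}(\mathcal E)$ be the set of ramification ideals. **Theorem.** Let $\mathcal E=(\Omega|K,v)$ be a finite Galois extension inside $\overline K$ with non-trivial defect, that is, $d(\Omega|K,v)=\dfrac{[\Omega:K]}{(v\Omega:vK)\,[\Omega v:Kv]}>1$, and assume that $\mathcal E$ has depth one. Then for every $a$ with $K(a)=\Omega$ that is pure over $K$, $$\#\mathrm{Ram}(\mathcal E)\le \#S_K(a).$$ -/

import Mathlib

noncomputable section

namespace RamDepth

/-!
Conventions. `K` is a field, `E` an algebraic closure of `K`, and `v` a Krull valuation on `E` (of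
arbitrary rank) whose restriction to `K` is the valuation of the base field; when `K` is henselian,
`v` is the unique extension of that restriction. Mathlib writes valuations multiplicatively:
`v x ≤ v y` here is what is written additively as `v x ≥ v y`, and the additive value `∞` of `0` is
`0` here. Hence an additive maximum is a least element here.
-/

universe u w

variable {K : Type*} [Field K] {E : Type u} [Field E] [Algebra K E]
  {Γ : Type w} [LinearOrderedCommGroupWithZero Γ]

/-- The degree over `K` of an element of the algebraic closure. -/
def deg (K : Type*) [Field K] {E : Type u} [Field E] [Algebra K E] (z : E) : ℕ :=
  (minpoly K z).natDegree

/-- The valuation ring `O_F` of `(F, v)`, for an intermediate field `F`. -/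
abbrev valRing (v : Valuation E Γ) (F : IntermediateField K E) : ValuationSubring F :=
  v.valuationSubring.comap (algebraMap F E)

/-! ### The defect -/

/-- The value group `vF`, as a subgroup of the group of all possible nonzero values. -/
def valGroup (v : Valuation E Γ) (F : IntermediateField K E) : Subgroup Γˣ where
  carrier := {γ | ∃ x ∈ F, v x = γ}
  mul_mem' := by
    rintro γ δ ⟨x, hx, hxγ⟩ ⟨y, hy, hyδ⟩
    exact ⟨x * y, F.mul_mem hx hy, by simp [hxγ, hyδ]⟩
  one_mem' := ⟨1, F.one_mem, by simp⟩
  inv_mem' := by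
    rintro γ ⟨x, hx, hxγ⟩
    exact ⟨x⁻¹, F.inv_mem hx, by simp [hxγ]⟩

/-- The residue field `Fv`, as a subfield of the residue field of `(E, v)`: it consists of the
residues of the elements of `F` that lie in the valuation ring. -/
def resField (v : Valuation E Γ) (F : IntermediateField K E) :
    Subfield (IsLocalRing.ResidueField v.valuationSubring) where
  carrier := {ξ | ∃ x : v.valuationSubring, (x : E) ∈ F ∧
    IsLocalRing.residue v.valuationSubring x = ξ}
  mul_mem' := by
    rintro _ _ ⟨x, hx, rfl⟩ ⟨y, hy, rfl⟩
    exact ⟨x * y, F.mul_mem hx hy, map_mul _ _ _⟩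
  one_mem' := ⟨1, F.one_mem, map_one _⟩
  add_mem' := by
    rintro _ _ ⟨x, hx, rfl⟩ ⟨y, hy, rfl⟩
    exact ⟨x + y, F.add_mem hx hy, map_add _ _ _⟩
  zero_mem' := ⟨0, F.zero_mem, map_zero _⟩
  neg_mem' := by
    rintro _ ⟨x, hx, rfl⟩
    exact ⟨-x, F.neg_mem hx, map_neg _ _⟩
  inv_mem' := by
    rintro _ ⟨x, hx, rfl⟩
    by_cases hu : IsUnit x
    · obtain ⟨y, rfl⟩ := hu
      have hE : ((↑y⁻¹ : v.valuationSubring) : E) = ((y : v.valuationSubring) : E)⁻¹ :=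
        eq_inv_of_mul_eq_one_left (congrArg Subtype.val y.inv_mul)
      refine ⟨(↑y⁻¹ : v.valuationSubring), hE ▸ F.inv_mem hx, ?_⟩
      exact map_units_inv _ _
    · refine ⟨0, F.zero_mem, ?_⟩
      have h0 : IsLocalRing.residue v.valuationSubring x = 0 := by
        rwa [IsLocalRing.residue_eq_zero_iff, IsLocalRing.mem_maximalIdeal]
      rw [h0, map_zero, inv_zero]

/-- The defect `d(F|K, v) = [F : K] / ((vF : vK) [Fv : Kv])` of a finite extension, as a rational
number. The base field `K` is the bottom intermediate field. -/
def defect (v : Valuation E Γ) (F : IntermediateField K E) : ℚ :=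
  (Module.finrank K F : ℚ) /
    ((valGroup v (⊥ : IntermediateField K E)).relIndex (valGroup v F) *
      Subfield.relfinrank (resField v (⊥ : IntermediateField K E)) (resField v F))

/-! ### Okutsu sequences, depth, purity -/

/-- The set `D_m(a, K)` of the values `v (z - a)`, for `z` of degree `m` over `K`. -/
def D (K : Type*) [Field K] {E : Type u} [Field E] [Algebra K E]
    {Γ : Type w} [LinearOrderedCommGroupWithZero Γ] (v : Valuation E Γ) (a : E) (m : ℕ) : Set Γ :=
  {γ | ∃ z : E, deg K z = m ∧ γ = v (z - a)}

/-- `A 0, …, A n` is an Okutsu sequence of `a` over `K`, of length `n`, where `d i` is the common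
degree over `K` of the elements of `A i`. Only the indices up to `n` matter. -/
structure IsOkutsuSequence (K : Type*) [Field K] {E : Type u} [Field E] [Algebra K E]
    {Γ : Type w} [LinearOrderedCommGroupWithZero Γ] (v : Valuation E Γ) (a : E)
    (n : ℕ) (A : ℕ → Set E) (d : ℕ → ℕ) : Prop where
  zero : A 0 = {a}
  common_degree : ∀ i ≤ n, ∀ z ∈ A i, deg K z = d i
  /-- The common degrees decrease strictly, from the degree of `a` to `1`. -/
  d_zero : d 0 = deg K a
  d_lt : ∀ i < n, d (i + 1) < d i
  d_last : d n = 1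
  /-- Among the elements of degree less than `d i`, those of `A (i + 1)` come closest to `a`. -/
  exists_closer : ∀ i < n, ∀ z : E, deg K z < d i → ∃ z' ∈ A (i + 1), v (a - z') ≤ v (a - z)
  /-- Elements of `A i` are strictly closer to `a` than those of `A (i + 1)`. -/
  closer : ∀ i < n, ∀ z ∈ A i, ∀ z' ∈ A (i + 1), v (a - z) < v (a - z')
  /-- `A (i + 1)` is a singleton if and only if the maximum of `D_{d (i + 1)}` exists; it is then
  attained there, and is the maximum over all elements of degree less than `d i` as well. -/
  singleton_iff : ∀ i < n,
    (∃ b, A (i + 1) = {b}) ↔ ∃ γ, IsLeast (D K v a (d (i + 1))) γ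
  max_of_singleton : ∀ i < n, ∀ b, A (i + 1) = {b} →
    IsLeast (D K v a (d (i + 1))) (v (a - b)) ∧
      IsLeast {γ | ∃ z : E, deg K z < d i ∧ γ = v (a - z)} (v (a - b))
  /-- Otherwise `A (i + 1)` is a sequence indexed by a limit ordinal, and `v (a - z ν)` increases
  strictly (additively written). -/
  limit : ∀ i < n, (¬ ∃ γ, IsLeast (D K v a (d (i + 1))) γ) →
    ∃ (l : Ordinal.{u}) (z : Ordinal.{u} → E), Order.IsSuccLimit l ∧
      A (i + 1) = z '' Set.Iio l ∧
      ∀ ν μ, ν < μ → μ < l → v (a - z μ) < v (a - z ν)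

/-- The depth of `a` over `K`: the (common) length of the Okutsu sequences of `a` over `K`. -/
def depth (K : Type*) [Field K] {E : Type u} [Field E] [Algebra K E]
    {Γ : Type w} [LinearOrderedCommGroupWithZero Γ] (v : Valuation E Γ) (a : E) : ℕ :=
  sInf {n | ∃ A d, IsOkutsuSequence K v a n A d}

/-- `a` is pure over `K`. -/
def IsPure (K : Type*) [Field K] {E : Type u} [Field E] [Algebra K E]
    {Γ : Type w} [LinearOrderedCommGroupWithZero Γ] (v : Valuation E Γ) (a : E) : Prop :=
  depth K v a = 1

/-- The depth of an extension `(Ω|K, v)`: the minimum of the depths of its generators. -/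
def extDepth (v : Valuation E Γ) (Ω : IntermediateField K E) : ℕ :=
  sInf {n | ∃ a : E, IntermediateField.adjoin K {a} = Ω ∧ n = depth K v a}

/-! ### Distances of conjugates, and ramification ideals -/

/-- `S_K(a)`: the values `v (a - a')`, for the `K`-conjugates `a' ≠ a` of `a`. -/
def S (K : Type*) [Field K] {E : Type u} [Field E] [Algebra K E]
    {Γ : Type w} [LinearOrderedCommGroupWithZero Γ] (v : Valuation E Γ) (a : E) : Set Γ :=
  {γ | ∃ a' : E, a' ≠ a ∧ IsConjRoot K a a' ∧ γ = v (a - a')}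

/-- The ideal `I_H` of `O_Ω` generated by the elements `σ z / z - 1`, for `σ ∈ H` and `z ≠ 0`. -/
def ramI (v : Valuation E Γ) (Ω : IntermediateField K E) (H : Subgroup (Ω ≃ₐ[K] Ω)) :
    Ideal (valRing v Ω) :=
  Ideal.span {x | ∃ σ ∈ H, ∃ z : Ω, z ≠ 0 ∧ (x : Ω) = σ z / z - 1}

/-- The set of ramification ideals of the extension `(Ω|K, v)`. -/
def Ram (v : Valuation E Γ) (Ω : IntermediateField K E) : Set (Ideal (valRing v Ω)) :=
  {I | I ≠ ⊥ ∧ I ≤ IsLocalRing.maximalIdeal (valRing v Ω) ∧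
    ∃ H : Subgroup (Ω ≃ₐ[K] Ω), I = ramI v Ω H}

end RamDepth

end

/-! Since `a` is pure, some `c` in `K` lies as close to `a` as any given element of smaller degree.
Write `z ≠ 0` in `Ω` as `f(a)` with `deg f < deg a`. Then `σ z / z` is the product of the quotients
`(σ a - r) / (a - r)` over the roots `r` of `f`. Each differs from 1 by `(σ a - a) / (a - r)`, whose
value is at most `v (σ a - a) / v (a - c)` for one `c` in `K` serving all the roots. Equality holds
for `z = a - c`.

Hence `I_H` depends only on the largest multiplicative value `v (σ a - a)` for `σ ∈ H`. When `I_H ≠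
0` this value lies in `S_K(a)`, and sending `I_H` to it is injective (`ramI_le_of_le`,
`encard_Ram_le`).

Henselianity enters through `v ∘ σ = v`, derived from Hensel's lemma in
`map_algEquiv_eq_of_henselian`. It gives `v (σ a - a) ≤ v (a - c)`, so the factors stay integral
when multiplied. -/

namespace RamDepth

open Polynomial

/-! ### Invariance of a henselian valuation under automorphisms -/

section Henselian

variable {K L Γ : Type*} [Field K] [Field L] [Algebra K L] [LinearOrderedCommGroupWithZero Γ]
  (w : Valuation L Γ)

/-- Hensel's lemma at the approximate root `1`, phrased through the valuation. -/
lemma exists_isRoot_of_henselian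
    (hK : HenselianLocalRing (w.valuationSubring.comap (algebraMap K L)))
    (f : K[X]) (hf : f.Monic) (hc : ∀ i, w (algebraMap K L (f.coeff i)) ≤ 1)
    (h1 : w (algebraMap K L (f.eval 1)) < 1)
    (h2 : w (algebraMap K L (f.derivative.eval 1)) = 1) : ∃ r, f.IsRoot r := by
  set R := w.valuationSubring.comap (algebraMap K L)
  have hmem : ∀ x : K, x ∈ R ↔ w (algebraMap K L x) ≤ 1 := fun x => by
    rw [ValuationSubring.mem_comap, Valuation.mem_valuationSubring_iff]
  have hlift : f ∈ lifts (algebraMap R K) := by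
    rw [lifts_iff_coeff_lifts]
    exact fun i => ⟨⟨f.coeff i, (hmem _).2 (hc i)⟩, rfl⟩
  obtain ⟨g, hg, -, hgm⟩ := lifts_and_natDegree_eq_and_monic hlift hf
  have hev : ∀ p : R[X], ((p.eval 1 : R) : K) = (p.map (algebraMap R K)).eval 1 := fun p => by
    rw [← map_one (algebraMap R K), eval_map_apply]; rfl
  obtain ⟨r, hr, -⟩ := hK.is_henselian g hgm 1
    (by
      rw [IsLocalRing.mem_maximalIdeal, mem_nonunits_iff, isUnit_iff_exists_inv]
      rintro ⟨y, hy⟩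
      have hy1 := (hmem _).1 y.2
      have hxy : w (algebraMap K L (f.eval 1)) * w (algebraMap K L (y : K)) = 1 := by
        rw [← map_mul, ← map_mul, ← hg, ← hev]
        have := congrArg (fun t : R => (t : K)) hy
        simp only [MulMemClass.coe_mul, OneMemClass.coe_one] at this
        rw [this, map_one, map_one]
      exact absurd hxy (mul_lt_one_of_lt_of_le h1 hy1).ne)
    (by
      have hne : f.derivative.eval 1 ≠ 0 := fun h => by
        rw [h, map_zero, map_zero] at h2; exact zero_ne_one h2
      have hd : ((g.derivative.eval 1 : R) : K) = f.derivative.eval 1 := by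
        rw [hev, ← derivative_map, hg]
      rw [isUnit_iff_exists_inv]
      refine ⟨⟨(f.derivative.eval 1)⁻¹, (hmem _).2 ?_⟩, ?_⟩
      · rw [map_inv₀, map_inv₀, h2, inv_one]
      · apply Subtype.ext
        change ((g.derivative.eval 1 : R) : K) * _ = 1
        rw [hd, mul_inv_cancel₀ hne])
  refine ⟨algebraMap R K r, ?_⟩
  rw [← hg]
  exact hr.map

lemma map_coeff_prod_X_sub_C_le_one (s : Multiset L) (hs : ∀ r ∈ s, w r ≤ 1) (i : ℕ) :
    w ((s.map fun r => X - C r).prod.coeff i) ≤ 1 := by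
  induction s using Multiset.induction_on generalizing i with
  | empty => simp only [Multiset.map_zero, Multiset.prod_zero, coeff_one]; split_ifs <;> simp
  | cons r s ih =>
    have ih := ih fun t ht => hs t (Multiset.mem_cons_of_mem ht)
    have hr : w r ≤ 1 := hs r (Multiset.mem_cons_self r s)
    rw [Multiset.map_cons, Multiset.prod_cons, sub_mul, coeff_sub, coeff_C_mul]
    refine w.map_sub_le ?_ ?_
    · cases i with
      | zero => simp
      | succ i => rw [coeff_X_mul]; exact ih i
    · rw [map_mul]; exact mul_le_one' hr (ih i)

lemma map_eval_le_one {p : L[X]} (hp : ∀ i, w (p.coeff i) ≤ 1) {x : L} (hx : w x ≤ 1) :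
    w (p.eval x) ≤ 1 := by
  rw [eval_eq_sum, Polynomial.sum]
  refine w.map_sum_le fun i _ => ?_
  rw [map_mul, map_pow]
  exact mul_le_one' (hp i) (pow_le_one' hx i)

variable [IsGalois K L]

/-- The conjugates of `θ`, without multiplicity, with `θ` itself split off. -/
lemma exists_roots_minpoly_eq_cons [FiniteDimensional K L] (θ : L) :
    ∃ t : Multiset L, ((minpoly K θ).map (algebraMap K L)).roots = θ ::ₘ t ∧
      ∀ r ∈ t, r ≠ θ ∧ ∃ σ : L ≃ₐ[K] L, σ θ = r := by
  have hint : IsIntegral K θ := Algebra.IsIntegral.isIntegral θ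
  have hmem : ∀ r, r ∈ ((minpoly K θ).map (algebraMap K L)).roots ↔ aeval r (minpoly K θ) = 0 := by
    intro r
    rw [mem_roots ((minpoly.monic hint).map _).ne_zero, IsRoot, eval_map_algebraMap]
  have hsep : (minpoly K θ).Separable := IsGalois.separable K θ
  have hnodup := nodup_roots (hsep.map (f := algebraMap K L))
  obtain ⟨t, ht⟩ := Multiset.exists_cons_of_mem ((hmem θ).2 (minpoly.aeval K θ))
  refine ⟨t, ht, fun r hr => ⟨?_, ?_⟩⟩
  · rintro rfl
    rw [ht] at hnodup
    exact (Multiset.nodup_cons.1 hnodup).1 hr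
  · exact minpoly.exists_algEquiv_of_root' hint.isAlgebraic
      ((hmem r).1 (ht ▸ Multiset.mem_cons_of_mem hr))

/-- Over a henselian field, an element congruent to `1`, all of whose other conjugates have residue
`0`, lies in the base field. -/
lemma mem_range_of_residue_one [FiniteDimensional K L]
    (hK : HenselianLocalRing (w.valuationSubring.comap (algebraMap K L))) (θ : L)
    (h1 : w (1 - θ) < 1) (h : ∀ σ : L ≃ₐ[K] L, σ θ = θ ∨ w (σ θ) < 1) :
    θ ∈ (algebraMap K L).range := by
  have hint : IsIntegral K θ := Algebra.IsIntegral.isIntegral θ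
  set f := minpoly K θ
  have hfm : f.Monic := minpoly.monic hint
  have hsplit : (f.map (algebraMap K L)).Splits := Normal.splits inferInstance θ
  have hprod := hsplit.eq_prod_roots_of_monic (hfm.map _)
  obtain ⟨t, ht, htσ⟩ := exists_roots_minpoly_eq_cons (K := K) θ
  have htlt : ∀ r ∈ t, w r < 1 := by
    intro r hr
    obtain ⟨hne, σ, rfl⟩ := htσ r hr
    exact (h σ).resolve_left hne
  have hθ1 : w θ = 1 := by
    have := w.map_one_sub_of_lt h1
    rwa [sub_sub_cancel] at this
  set s := (f.map (algebraMap K L)).roots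
  set g := (t.map fun r => X - C r).prod with hg
  have hfg : f.map (algebraMap K L) = (X - C θ) * g := by
    rw [hprod, ht, Multiset.map_cons, Multiset.prod_cons]
  have hgc : ∀ i, w (g.coeff i) ≤ 1 :=
    map_coeff_prod_X_sub_C_le_one w t fun r hr => (htlt r hr).le
  have hgc' : ∀ i, w (g.derivative.coeff i) ≤ 1 := by
    intro i
    rw [coeff_derivative, map_mul]
    refine mul_le_one' (hgc _) ?_
    rw [← Nat.cast_succ]
    exact (w.mem_valuationSubring_iff _).1 (natCast_mem _ _)
  have hg1 : w (g.eval 1) = 1 := by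
    rw [hg, eval_multiset_prod, map_multiset_prod]
    simp only [Multiset.map_map]
    refine Multiset.prod_eq_one fun x hx => ?_
    obtain ⟨r, hr, rfl⟩ := Multiset.mem_map.1 hx
    simpa using w.map_one_sub_of_lt (htlt r hr)
  have heval : ∀ p : K[X], algebraMap K L (p.eval 1) = (p.map (algebraMap K L)).eval 1 := by
    intro p; rw [← map_one (algebraMap K L), eval_map_apply]
  -- Modulo the maximal ideal `f` is `X - 1` times a power of `X`, so 1 is a simple root of the
  -- reduction. The root given by Hensel's lemma forces the irreducible `f` to be linear.
  obtain ⟨r, hr⟩ := exists_isRoot_of_henselian w hK f hfm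
    (by
      intro i
      rw [← coeff_map, hprod]
      refine map_coeff_prod_X_sub_C_le_one w s (fun r hr => ?_) i
      rw [ht] at hr
      rcases Multiset.mem_cons.1 hr with rfl | hr
      · exact hθ1.le
      · exact (htlt r hr).le)
    (by
      rw [heval, hfg, eval_mul, map_mul, hg1, mul_one]
      simpa using h1)
    (by
      rw [heval, ← derivative_map, hfg, derivative_mul, eval_add, eval_mul, eval_mul]
      simp only [derivative_sub, derivative_X, derivative_C, sub_zero, eval_one, one_mul, eval_sub,
        eval_X, eval_C]
      rw [w.map_add_eq_of_lt_left, hg1]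
      rw [hg1, map_mul]
      exact mul_lt_one_of_lt_of_le h1 (map_eval_le_one w hgc' (map_one w).le))
  exact minpoly.mem_range_of_degree_eq_one K θ
    (degree_eq_one_of_irreducible_of_root (minpoly.irreducible hint) hr)

/-- Over a henselian field, an element that strictly dominates its other conjugates lies in the
base field. -/
lemma mem_range_of_dominant [FiniteDimensional K L]
    (hK : HenselianLocalRing (w.valuationSubring.comap (algebraMap K L))) (θ : L)
    (h : ∀ σ : L ≃ₐ[K] L, σ θ = θ ∨ w (σ θ) < w θ) :
    θ ∈ (algebraMap K L).range := by
  by_cases hθ : θ = 0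
  · rw [hθ]; exact zero_mem _
  have hwθ : w θ ≠ 0 := (w.ne_zero_iff).2 hθ
  have hint : IsIntegral K θ := Algebra.IsIntegral.isIntegral θ
  set f := minpoly K θ
  have hfm : f.Monic := minpoly.monic hint
  have hsplit : (f.map (algebraMap K L)).Splits := Normal.splits inferInstance θ
  have hsum := hsplit.nextCoeff_eq_neg_sum_roots_of_monic (hfm.map _)
  rw [nextCoeff_map (algebraMap K L).injective] at hsum
  obtain ⟨t, ht, htσ⟩ := exists_roots_minpoly_eq_cons (K := K) θ
  have htlt : ∀ r ∈ t, w r < w θ := by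
    intro r hr
    obtain ⟨hne, σ, rfl⟩ := htσ r hr
    exact (h σ).resolve_left hne
  have hsumt : ∀ t : Multiset L, (∀ r ∈ t, w r < w θ) → w t.sum < w θ := by
    intro t
    induction t using Multiset.induction_on with
    | empty => intro _; simpa using zero_lt_iff.2 hwθ
    | cons r t ih =>
      intro hr
      rw [Multiset.sum_cons]
      exact w.map_add_lt (hr r (Multiset.mem_cons_self r t))
        (ih fun x hx => hr x (Multiset.mem_cons_of_mem hx))
  have hlt := hsumt t htlt
  have hc : algebraMap K L (-f.nextCoeff) = θ + t.sum := by
    rw [map_neg, hsum, neg_neg, ht, Multiset.sum_cons]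
  set c := -f.nextCoeff
  have hwc : w (algebraMap K L c) = w θ := by rw [hc, w.map_add_eq_of_lt_left hlt]
  have hc0 : algebraMap K L c ≠ 0 := (w.ne_zero_iff).1 (hwc ▸ hwθ)
  have hpos : 0 < w θ := zero_lt_iff.2 hwθ
  -- The sum `c` of the conjugates lies in `K` and is dominated by `θ`, so `θ / c` is congruent to 1
  -- and its other conjugates have residue 0.
  obtain ⟨k, hk⟩ := mem_range_of_residue_one w hK (θ / algebraMap K L c)
    (by
      rw [one_sub_div hc0, hc, add_sub_cancel_left, ← hc, map_div₀, hwc]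
      exact (div_lt_one₀ hpos).2 hlt)
    (by
      intro σ
      rw [map_div₀, AlgEquiv.commutes, map_div₀, hwc, div_lt_one₀ hpos]
      exact (h σ).imp_left fun h => by rw [h])
  refine ⟨k * c, ?_⟩
  rw [map_mul, hk, div_mul_cancel₀ _ hc0]

/-- The valuation of a henselian field extends uniquely: it is invariant under automorphisms. -/
theorem map_algEquiv_eq_of_henselian [FiniteDimensional K L]
    (hK : HenselianLocalRing (w.valuationSubring.comap (algebraMap K L)))
    (σ : L ≃ₐ[K] L) (z : L) : w (σ z) = w z := by
  classical
  by_cases hz : z = 0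
  · simp [hz]
  obtain ⟨σ₀, hσ₀⟩ := Finite.exists_max fun τ : L ≃ₐ[K] L => w (τ z)
  set M := w (σ₀ z)
  have hM : 0 < M := zero_lt_iff.2 ((w.ne_zero_iff).2 (by simpa using hz))
  let T : Finset (L ≃ₐ[K] L) := Finset.univ.filter fun τ => w (τ z) = M
  have hT : ∀ τ, τ ∈ T ↔ w (τ z) = M := fun τ => by simp [T]
  -- The product of all `τ z` of maximal value: any `ρ` moving `T` replaces some factor by a
  -- strictly smaller one, so `P` dominates its other conjugates.
  set P := ∏ τ ∈ T, τ z
  have hwP : w P = M ^ T.card := by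
    rw [map_prod, Finset.prod_congr rfl fun τ hτ => (hT τ).1 hτ, Finset.prod_const]
  have hP : ∀ ρ : L ≃ₐ[K] L, ρ P = ∏ τ ∈ T.image (ρ * ·), τ z := by
    intro ρ
    rw [Finset.prod_image fun _ _ _ _ h => mul_left_cancel h, map_prod]
    rfl
  have hcard : ∀ ρ : L ≃ₐ[K] L, (T.image (ρ * ·)).card = T.card := fun ρ =>
    Finset.card_image_of_injective _ (mul_right_injective ρ)
  have hdich : ∀ ρ : L ≃ₐ[K] L, T.image (ρ * ·) = T ∨ w (ρ P) < w P := by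
    intro ρ
    by_cases hsub : T.image (ρ * ·) ⊆ T
    · exact Or.inl (Finset.eq_of_subset_of_card_le hsub (hcard ρ).ge)
    · right
      obtain ⟨τ, hτ, hτT⟩ := Finset.not_subset.1 hsub
      have hlt : w (τ z) < M := lt_of_le_of_ne (hσ₀ τ) fun h => hτT ((hT τ).2 h)
      rw [hP, hwP, ← Finset.mul_prod_erase _ _ hτ, map_mul, map_prod, ← hcard ρ,
        ← Finset.card_erase_add_one hτ, pow_succ']
      exact (mul_le_mul_right (Finset.prod_le_pow_card _ _ _ fun x _ => hσ₀ x) _).trans_lt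
        (mul_lt_mul_of_pos_right hlt (pow_pos hM _))
  obtain ⟨k, hk⟩ := mem_range_of_dominant w hK P fun ρ =>
    (hdich ρ).imp_left fun h => by rw [hP, h]
  -- As `P` lies in `K`, no `ρ` can lower its value. So the nonempty set `T` is stable under left
  -- translation and is the whole group.
  have hstable : ∀ ρ : L ≃ₐ[K] L, T.image (ρ * ·) = T := fun ρ =>
    (hdich ρ).resolve_right fun h => by
      rw [← hk, AlgEquiv.commutes] at h; exact lt_irrefl _ h
  have hall : ∀ ρ : L ≃ₐ[K] L, w (ρ z) = M := by
    intro ρ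
    rw [← hT, ← hstable (ρ * σ₀⁻¹), Finset.mem_image]
    exact ⟨σ₀, (hT σ₀).2 rfl, inv_mul_cancel_right ρ σ₀⟩
  rw [hall σ, ← hall 1]
  rfl

end Henselian

end RamDepth

namespace RamDepth

open Polynomial

/-! ### Approximation of pure elements and of polynomials in them -/

section Pure

universe u w

variable {K : Type*} [Field K] {E : Type u} [Field E] [Algebra K E]
  {Γ : Type w} [LinearOrderedCommGroupWithZero Γ] (v : Valuation E Γ)

/-- A pure element is approximated by `K` as well as by any element of smaller degree. -/
lemma IsPure.exists_closer {v : Valuation E Γ} {a : E} (h : IsPure K v a) :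
    1 < deg K a ∧ ∀ z : E, deg K z < deg K a → ∃ c : K, v (a - algebraMap K E c) ≤ v (a - z) := by
  have h1 : (1 : ℕ) ∈ {n | ∃ A d, IsOkutsuSequence K v a n A d} := by
    -- The infimum of the empty set is 0, so depth 1 guarantees that an Okutsu sequence exists.
    have hne : {n | ∃ A d, IsOkutsuSequence K v a n A d}.Nonempty :=
      Nat.nonempty_of_pos_sInf (by rw [show sInf _ = 1 from h]; exact one_pos)
    rw [← show depth K v a = 1 from h]
    exact Nat.sInf_mem hne
  obtain ⟨A, d, hA⟩ := h1
  rw [← hA.d_zero]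
  refine ⟨hA.d_last ▸ hA.d_lt 0 one_pos, fun z hz => ?_⟩
  obtain ⟨z', hz', hle⟩ := hA.exists_closer 0 one_pos z hz
  have hdeg : deg K z' = 1 := (hA.common_degree 1 le_rfl z' hz').trans hA.d_last
  obtain ⟨c, rfl⟩ := minpoly.natDegree_eq_one_iff.1 hdeg
  exact ⟨c, hle⟩

lemma map_mul_sub_one_le {ε : Γ} (hε : ε ≤ 1) {x y : E} (hx : v (x - 1) ≤ ε)
    (hy : v (y - 1) ≤ ε) : v (x * y - 1) ≤ ε := by
  have hy1 : v y ≤ 1 := by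
    have := v.map_add_le (hy.trans hε) (map_one v).le
    rwa [sub_add_cancel] at this
  rw [show x * y - 1 = (x - 1) * y + (y - 1) by ring]
  refine v.map_add_le ?_ hy
  rw [map_mul]
  exact (mul_le_mul_left hx _).trans (mul_le_of_le_one_right' hy1)

lemma map_prod_sub_div_sub_one_le {a b : E} {δ : Γ} (hδ : δ ≠ 0) (hb : v (b - a) ≤ δ)
    (s : Multiset E) (hs : ∀ r ∈ s, δ ≤ v (a - r)) :
    v ((s.map (b - ·)).prod / (s.map (a - ·)).prod - 1) ≤ v (b - a) / δ := by
  have hpos : 0 < δ := zero_lt_iff.2 hδ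
  induction s using Multiset.induction_on with
  | empty => simp
  | cons r s ih =>
    have hr : δ ≤ v (a - r) := hs r (Multiset.mem_cons_self r s)
    have hr0 : a - r ≠ 0 := (v.ne_zero_iff).1 (hpos.trans_le hr).ne'
    rw [Multiset.map_cons, Multiset.map_cons, Multiset.prod_cons, Multiset.prod_cons,
      mul_div_mul_comm]
    refine map_mul_sub_one_le v ((div_le_one₀ hpos).2 hb) ?_
      (ih fun x hx => hs x (Multiset.mem_cons_of_mem hx))
    rw [div_sub_one hr0, sub_sub_sub_cancel_right, map_div₀]
    exact div_le_div_of_nonneg_left zero_le hpos hr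

variable {v} {a : E} (ha : 1 < deg K a)
  (hclose : ∀ z : E, deg K z < deg K a → ∃ c : K, v (a - algebraMap K E c) ≤ v (a - z))

include hclose in
-- Of finitely many approximations in `K`, the closest to `a` serves all of `s`.
lemma exists_map_sub_le_forall_mem (s : Multiset E) (hs : ∀ r ∈ s, deg K r < deg K a) :
    ∃ c : K, ∀ r ∈ s, v (a - algebraMap K E c) ≤ v (a - r) := by
  induction s using Multiset.induction_on with
  | empty => exact ⟨0, by simp⟩
  | cons r s ih =>
    obtain ⟨c, hc⟩ := ih fun x hx => hs x (Multiset.mem_cons_of_mem hx)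
    obtain ⟨d, hd⟩ := hclose r (hs r (Multiset.mem_cons_self r s))
    rcases le_total (v (a - algebraMap K E c)) (v (a - algebraMap K E d)) with h | h
    · refine ⟨c, fun x hx => ?_⟩
      rcases Multiset.mem_cons.1 hx with rfl | hx
      exacts [h.trans hd, hc x hx]
    · refine ⟨d, fun x hx => ?_⟩
      rcases Multiset.mem_cons.1 hx with rfl | hx
      exacts [hd, h.trans (hc x hx)]

lemma sub_algebraMap_ne_zero {a : E} (ha : 1 < deg K a) (c : K) : a - algebraMap K E c ≠ 0 := by
  intro h
  rw [sub_eq_zero.1 h, deg, minpoly.natDegree_eq_one_iff.2 ⟨c, rfl⟩] at ha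
  exact lt_irrefl _ ha

include ha hclose in
-- Each root of `f` has a minimal polynomial dividing `f`, hence degree below that of `a`, and
-- purity applies to it. The leading coefficient cancels in the quotient.
lemma exists_map_aeval_div_sub_one_le [IsAlgClosed E] {b : E}
    (hb : ∀ c : K, v (b - a) ≤ v (a - algebraMap K E c)) {f : K[X]} (hf : f ≠ 0)
    (hdeg : f.natDegree < deg K a) :
    ∃ c : K, v (aeval b f / aeval a f - 1) ≤ v (b - a) / v (a - algebraMap K E c) := by
  obtain ⟨c, hc⟩ := exists_map_sub_le_forall_mem hclose (f.aroots E) fun r hr =>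
    (natDegree_le_of_dvd (minpoly.dvd K r (mem_aroots.1 hr).2) hf).trans_lt hdeg
  refine ⟨c, ?_⟩
  have hsplit : (f.map (algebraMap K E)).Splits := IsAlgClosed.splits _
  have hlc : algebraMap K E f.leadingCoeff ≠ 0 := by simpa using hf
  rw [hsplit.aeval_eq_prod_aroots, hsplit.aeval_eq_prod_aroots, mul_div_mul_left _ _ hlc]
  exact map_prod_sub_div_sub_one_le v ((v.ne_zero_iff).2 (sub_algebraMap_ne_zero ha c)) (hb c) _ hc

end Pure

/-! ### Ramification ideals and distances of conjugates -/

section Galois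

open IntermediateField

universe u w

variable {K : Type*} [Field K] {E : Type u} [Field E] [Algebra K E]
  {Γ : Type w} [LinearOrderedCommGroupWithZero Γ] {v : Valuation E Γ}

lemma map_coe_algEquiv_eq {Ω : IntermediateField K E} [FiniteDimensional K Ω] [IsGalois K Ω]
    (hK : HenselianLocalRing (v.valuationSubring.comap (algebraMap K E)))
    (σ : Ω ≃ₐ[K] Ω) (z : Ω) : v (σ z) = v z :=
  map_algEquiv_eq_of_henselian (v.comap (algebraMap Ω E)) hK σ z

variable {a : E} {Ω : IntermediateField K E} (hΩ : adjoin K {a} = Ω)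

lemma coe_aeval (f : K[X]) (x : Ω) : ((aeval x f : Ω) : E) = aeval (x : E) f :=
  (aeval_algebraMap_apply E x f).symm

include hΩ in
lemma exists_eq_aeval_natDegree_lt [FiniteDimensional K Ω] (α : Ω) (hα : (α : E) = a) (z : Ω) :
    ∃ f : K[X], f.natDegree < deg K a ∧ z = aeval α f := by
  subst hΩ
  have hint : IsIntegral K a := hα ▸ (Algebra.IsIntegral.isIntegral (R := K) α).map (val _)
  obtain ⟨f, hf, hz⟩ := (adjoin.powerBasis hint).exists_eq_aeval z
  refine ⟨f, by simpa [deg] using hf, ?_⟩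
  rw [hz, adjoin.powerBasis_gen]
  exact congrArg (fun x => aeval x f) (Subtype.ext hα.symm)

variable [FiniteDimensional K Ω] [IsGalois K Ω]
  (hK : HenselianLocalRing (v.valuationSubring.comap (algebraMap K E)))
  (α : Ω) (hα : (α : E) = a)

include hK hα in
-- `σ a - c` and `a - c` are conjugate, so they have the same value, which bounds that of their
-- difference.
lemma map_algEquiv_sub_le (σ : Ω ≃ₐ[K] Ω) (c : K) :
    v (σ α - a) ≤ v (a - algebraMap K E c) := by
  have h := map_coe_algEquiv_eq hK σ (α - algebraMap K Ω c)
  rw [map_sub, AlgEquiv.commutes] at h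
  have h' : v (σ α - algebraMap K E c) = v (a - algebraMap K E c) := hα ▸ h
  rw [← sub_sub_sub_cancel_right _ _ (algebraMap K E c)]
  exact v.map_sub_le h'.le le_rfl

variable [IsAlgClosed E] (ha : 1 < deg K a)
  (hclose : ∀ z : E, deg K z < deg K a → ∃ c : K, v (a - algebraMap K E c) ≤ v (a - z))

include hΩ hK hα ha hclose in
lemma exists_map_algEquiv_div_sub_one_le (σ : Ω ≃ₐ[K] Ω) {z : Ω} (hz : z ≠ 0) :
    ∃ c : K, v ((σ z / z - 1 : Ω) : E) ≤ v (σ α - a) / v (a - algebraMap K E c) := by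
  obtain ⟨f, hf, rfl⟩ := exists_eq_aeval_natDegree_lt hΩ α hα z
  have hf0 : f ≠ 0 := by rintro rfl; simp at hz
  obtain ⟨c, hc⟩ := exists_map_aeval_div_sub_one_le ha hclose
    (map_algEquiv_sub_le hK α hα σ) hf0 hf
  refine ⟨c, ?_⟩
  rw [← aeval_algHom_apply]
  push_cast
  rw [coe_aeval, coe_aeval, hα]
  exact hc

include hΩ hK hα ha hclose in
/-- The ideal `I_H` depends only on the least distance (multiplicatively: the largest value) of `a`
from its conjugates under `H`. -/
lemma ramI_le_of_le {H H' : Subgroup (Ω ≃ₐ[K] Ω)} {τ : Ω ≃ₐ[K] Ω} (hτ : τ ∈ H')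
    (hle : ∀ σ ∈ H, v (σ α - a) ≤ v (τ α - a)) : ramI v Ω H ≤ ramI v Ω H' := by
  refine Ideal.span_le.2 ?_
  rintro x ⟨σ, hσ, z, hz, hx⟩
  obtain ⟨c, hc⟩ := exists_map_algEquiv_div_sub_one_le hΩ hK α hα ha hclose σ hz
  have hy0 : α - algebraMap K Ω c ≠ 0 := fun h =>
    sub_algebraMap_ne_zero ha c (by rw [← hα]; exact congrArg (algebraMap Ω E) h)
  -- The bound for the generator `x` involves this `c`; `z = a - c` attains it with `τ`, so `x` is a
  -- multiple of `y`.
  set y : Ω := τ (α - algebraMap K Ω c) / (α - algebraMap K Ω c) - 1 with hy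
  have hvy : v (y : E) = v (τ α - a) / v (a - algebraMap K E c) := by
    rw [hy, div_sub_one hy0, map_sub, AlgEquiv.commutes, sub_sub_sub_cancel_right, ← map_div₀, ← hα]
    rfl
  have hxy : v ((x : Ω) : E) ≤ v (y : E) := by
    rw [hx, hvy]
    exact hc.trans (div_le_div_of_nonneg_right (hle σ hσ) zero_le)
  have hpos : 0 < v (a - algebraMap K E c) :=
    zero_lt_iff.2 ((v.ne_zero_iff).2 (sub_algebraMap_ne_zero ha c))
  have hymem : y ∈ valRing v Ω := by
    rw [ValuationSubring.mem_comap, Valuation.mem_valuationSubring_iff]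
    exact hvy.le.trans ((div_le_one₀ hpos).2 (map_algEquiv_sub_le hK α hα τ c))
  have hyI : (⟨y, hymem⟩ : valRing v Ω) ∈ ramI v Ω H' :=
    Ideal.subset_span ⟨τ, hτ, _, hy0, rfl⟩
  by_cases h0 : y = 0
  · rw [h0, ZeroMemClass.coe_zero, map_zero, le_zero_iff, v.zero_iff] at hxy
    have : x = 0 := Subtype.ext (Subtype.ext hxy)
    rw [this]
    exact zero_mem _
  have hqmem : (x : Ω) / y ∈ valRing v Ω := by
    rw [ValuationSubring.mem_comap, Valuation.mem_valuationSubring_iff, map_div₀, map_div₀]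
    refine (div_le_one₀ (zero_lt_iff.2 ((v.ne_zero_iff).2 ?_))).2 hxy
    simpa using h0
  have hprod : x = ⟨(x : Ω) / y, hqmem⟩ * ⟨y, hymem⟩ :=
    Subtype.ext (div_mul_cancel₀ (x : Ω) h0).symm
  rw [hprod]
  exact Ideal.mul_mem_left _ _ hyI

omit [FiniteDimensional K Ω] [IsGalois K Ω] [IsAlgClosed E] in
lemma ramI_bot (v : Valuation E Γ) (Ω : IntermediateField K E) : ramI v Ω ⊥ = ⊥ := by
  refine Ideal.span_eq_bot.2 ?_
  rintro x ⟨σ, hσ, z, hz, hx⟩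
  rw [Subgroup.mem_bot.1 hσ, AlgEquiv.one_apply, div_self hz, sub_self] at hx
  exact Subtype.ext hx

include hΩ hα in
omit [FiniteDimensional K Ω] [IsGalois K Ω] [IsAlgClosed E] in
lemma map_sub_algEquiv_mem_S {σ : Ω ≃ₐ[K] Ω} (hσ : σ ≠ 1) : v (σ α - a) ∈ S K v a := by
  refine ⟨σ α, fun h => hσ ?_, ?_, v.map_sub_swap _ _⟩
  · have : (σ : Ω →ₐ[K] Ω) = AlgHom.id K Ω :=
      algHom_ext_of_eq_adjoin K hΩ.symm fun x hx => by
        obtain rfl := Set.mem_singleton_iff.1 hx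
        have hαx : (⟨x, hΩ ▸ subset_adjoin K {x} hx⟩ : Ω) = α := Subtype.ext hα.symm
        change σ ⟨x, _⟩ = ⟨x, _⟩
        rw [hαx]
        exact Subtype.ext (h.trans hα.symm)
    exact AlgEquiv.ext fun z => DFunLike.congr_fun this z
  · have h₁ := minpoly.algHom_eq (val Ω) (val Ω).injective α
    have h₂ := minpoly.algHom_eq (val Ω) (val Ω).injective (σ α)
    rw [show val Ω α = a from hα] at h₁
    exact h₁.trans ((minpoly.algEquiv_eq σ α).symm.trans h₂.symm)

include hΩ hK hα ha hclose in
lemma encard_Ram_le : (Ram v Ω).encard ≤ (S K v a).encard := by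
  have key : ∀ I : Ideal (valRing v Ω), ∃ γ : Γ, I ∈ Ram v Ω → γ ∈ S K v a ∧
      ∃ H : Subgroup (Ω ≃ₐ[K] Ω), I = ramI v Ω H ∧ (∃ τ ∈ H, v (τ α - a) = γ) ∧
        ∀ σ ∈ H, v (σ α - a) ≤ γ := by
    intro I
    by_cases hI : I ∈ Ram v Ω
    swap
    · exact ⟨0, fun h => absurd h hI⟩
    obtain ⟨hbot, -, H, rfl⟩ := hI
    have hH : H ≠ ⊥ := by rintro rfl; exact hbot (ramI_bot v Ω)
    obtain ⟨ρ, hρ⟩ := Subgroup.ne_bot_iff_exists_ne_one.1 hH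
    have hρ1 : (ρ : Ω ≃ₐ[K] Ω) ≠ 1 := fun h => hρ (Subtype.ext h)
    obtain ⟨τ, hτ⟩ := Finite.exists_max fun σ : H => v ((σ : Ω ≃ₐ[K] Ω) α - a)
    refine ⟨v ((τ : Ω ≃ₐ[K] Ω) α - a), fun _ => ⟨map_sub_algEquiv_mem_S hΩ α hα ?_, H, rfl,
      ⟨τ, τ.2, rfl⟩, fun σ hσ => hτ ⟨σ, hσ⟩⟩⟩
    -- If the maximum were attained at 1 it would be 0, and `ρ ≠ 1` would fix the generator `a`.
    intro h1
    obtain ⟨b, hb, -, hρb⟩ := map_sub_algEquiv_mem_S (v := v) hΩ α hα hρ1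
    have := hτ ρ
    rw [h1, hρb, AlgEquiv.one_apply, hα, sub_self, map_zero, le_zero_iff, v.zero_iff] at this
    exact hb (sub_eq_zero.1 this).symm
  choose φ hφ using key
  refine Set.encard_le_encard_of_injOn (f := φ) (fun I hI => (hφ I hI).1) fun I hI J hJ hIJ => ?_
  obtain ⟨-, H, hIH, ⟨τ, hτ, hτI⟩, hmax⟩ := hφ I hI
  obtain ⟨-, H', hJH, ⟨τ', hτ', hτJ⟩, hmax'⟩ := hφ J hJ
  rw [hIH, hJH]
  exact le_antisymm
    (ramI_le_of_le hΩ hK α hα ha hclose hτ' fun σ hσ => (hmax σ hσ).trans (hIJ.trans hτJ.symm).le)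
    (ramI_le_of_le hΩ hK α hα ha hclose hτ fun σ hσ => (hmax' σ hσ).trans (hIJ ▸ hτI).ge)

end Galois

end RamDepth

theorem theorem8p16 {K : Type*} [Field K] {E : Type*} [Field E] [Algebra K E] [IsAlgClosure K E]
    {Γ : Type*} [LinearOrderedCommGroupWithZero Γ] (v : Valuation E Γ)
    (hK : HenselianLocalRing (v.valuationSubring.comap (algebraMap K E)))
    (Ω : IntermediateField K E) [FiniteDimensional K Ω] [IsGalois K Ω]
    (hdefect : 1 < RamDepth.defect v Ω)
    (hdepth : RamDepth.extDepth v Ω = 1)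
    (a : E) (ha : IntermediateField.adjoin K {a} = Ω) (hpure : RamDepth.IsPure K v a) :
    (RamDepth.Ram v Ω).encard ≤ (RamDepth.S K v a).encard := by
  have : IsAlgClosed E := IsAlgClosure.isAlgClosed K
  obtain ⟨hdeg, hclose⟩ := hpure.exists_closer
  exact RamDepth.encard_Ram_le ha hK
    ⟨a, ha ▸ IntermediateField.mem_adjoin_simple_self K a⟩ rfl hdeg hclose
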